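/- Let $X$ be a complex Banach space and let $T$ be a bounded linear operator on $X$, with null space $N(T)$ and range $R(T)$. Definitions. Put $\alpha(T)=\dim N(T)$ and $\beta(T)=\dim X/R(T)$, with values in $\{0,1,2,\dots\}\cup\{\infty\}$. $T$ is bounded below if it is injective and $R(T)$ is closed. $T$ is upper semi-Fredholm if $\alpha(T)<\infty$ and $R(T)$ is closed, and lower semi-Fredholm if $\beta(T)<\infty$; in either case $\operatorname{ind}(T)=\alpha(T)-\beta(T)\in\mathbb Z\cup\{\pm\infty\}$. $T$ is upper semi-Weyl if it is upper semi-Fredholm with $\operatorname{ind}(T)\le 0$, and lower semi-Weyl if it is lower semi-Fredholm with $\operatorname{ind}(T)\ge 0$. The ascent (descent) of $T$ is the least $n\ge 0$ with $N(T^n)=N(T^{n+1})$ (with $R(T^n)=R(T^{n+1})$), and $\infty$ if there is none. $T$ is Browder if it is both upper and lower semi-Fredholm and has finite ascent and finite descent. $T$ is Drazin invertible if there are an integer $n\ge 1$ and a bounded operator $S$ on $X$ with $ST=TS$, $STS=S$ and $T^{n+1}S=T^n$. $T$ is meromorphic if $\lambda I-T$ is Drazin invertible for every $\lambda\in\mathbb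 C\setminus\{0\}$. For $n\ge 0$ let $T_{[n]}:R(T^n)\to R(T^n)$ be the restriction of $T$. $T$ is upper (lower) semi B-Weyl if for some $n\ge 0$ the range $R(T^n)$ is closed and $T_{[n]}$ is upper (lower) semi-Fredholm with $\operatorname{ind}(T_{[n]})\le 0$ (with $\operatorname{ind}(T_{[n]})\ge 0$). $T$ is generalized Drazin-meromorphic surjective (bounded below) if $X=M\oplus N$ for closed $T$-invariant subspaces $M,N$ such that $T|_M:M\to M$ is surjective (bounded below) and $T|_N:N\to N$ is meromorphic. Theorem. (i) $T$ is Drazin invertible if and only if $T$ is upper semi B-Weyl and generalized Drazin-meromorphic surjective. (ii) $T$ is Drazin invertible if and only if $T$ is lower semi B-Weyl and generalized Drazin-meromorphic bounded below. (iii) $T$ is Browder if and only if $T$ is upper semi-Weyl and generalized Drazin-meromorphic surjective. (iv) $T$ is Browder if and only if $T$ is lower semi-Weyl and generalized Drazin-meromorphic bounded below. -/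

import Mathlib

noncomputable section

namespace BanachOp

variable {X : Type*} [NormedAddCommGroup X] [NormedSpace ℂ X]

/-- Nullity `α(T) = dim N(T)`, with value `⊤` when the kernel is infinite dimensional. -/
def nullity (T : X →L[ℂ] X) : ℕ∞ :=
  Cardinal.toENat (Module.rank ℂ (LinearMap.ker (T : X →ₗ[ℂ] X)))

/-- Deficiency `β(T) = codim R(T)` (algebraic codimension), with value `⊤` when it is infinite. -/
def deficiency (T : X →L[ℂ] X) : ℕ∞ :=
  Cardinal.toENat (Module.rank ℂ (X ⧸ LinearMap.range (T : X →ₗ[ℂ] X)))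

/-- Index `α(T) - β(T)`, an extended integer. It is only used for semi-Fredholm operators,
for which `α(T)` and `β(T)` are not both infinite. -/
def index (T : X →L[ℂ] X) : EReal :=
  (((nullity T : ℕ∞) : ENNReal) : EReal) - (((deficiency T : ℕ∞) : ENNReal) : EReal)

/-- The range of `T` is a closed subset. -/
def HasClosedRange (T : X →L[ℂ] X) : Prop :=
  IsClosed (LinearMap.range (T : X →ₗ[ℂ] X) : Set X)

def IsBoundedBelow (T : X →L[ℂ] X) : Prop :=
  Function.Injective T ∧ HasClosedRange T

def IsUpperSemiFredholm (T : X →L[ℂ] X) : Prop :=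
  nullity T < ⊤ ∧ HasClosedRange T

/-- On a Banach space, finite codimension of the range forces the range to be closed. -/
def IsLowerSemiFredholm (T : X →L[ℂ] X) : Prop :=
  deficiency T < ⊤

def IsUpperSemiWeyl (T : X →L[ℂ] X) : Prop :=
  IsUpperSemiFredholm T ∧ index T ≤ 0

def IsLowerSemiWeyl (T : X →L[ℂ] X) : Prop :=
  IsLowerSemiFredholm T ∧ 0 ≤ index T

/-- Ascent: the least `n` with `N(T^n) = N(T^(n+1))`, and `⊤` if there is none. -/
def ascent (T : X →L[ℂ] X) : ℕ∞ :=
  ⨅ (n : ℕ) (_ : LinearMap.ker ((T ^ n : X →L[ℂ] X) : X →ₗ[ℂ] X) =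
    LinearMap.ker ((T ^ (n + 1) : X →L[ℂ] X) : X →ₗ[ℂ] X)), (n : ℕ∞)

/-- Descent: the least `n` with `R(T^n) = R(T^(n+1))`, and `⊤` if there is none. -/
def descent (T : X →L[ℂ] X) : ℕ∞ :=
  ⨅ (n : ℕ) (_ : LinearMap.range ((T ^ n : X →L[ℂ] X) : X →ₗ[ℂ] X) =
    LinearMap.range ((T ^ (n + 1) : X →L[ℂ] X) : X →ₗ[ℂ] X)), (n : ℕ∞)

def IsUpperSemiBrowder (T : X →L[ℂ] X) : Prop :=
  IsUpperSemiFredholm T ∧ ascent T < ⊤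

def IsLowerSemiBrowder (T : X →L[ℂ] X) : Prop :=
  IsLowerSemiFredholm T ∧ descent T < ⊤

def IsBrowder (T : X →L[ℂ] X) : Prop :=
  IsUpperSemiBrowder T ∧ IsLowerSemiBrowder T

def IsDrazinInvertible (T : X →L[ℂ] X) : Prop :=
  ∃ (n : ℕ) (S : X →L[ℂ] X), 0 < n ∧ S * T = T * S ∧ S * T * S = S ∧ T ^ (n + 1) * S = T ^ n

def IsMeromorphic (T : X →L[ℂ] X) : Prop :=
  ∀ z : ℂ, z ≠ 0 → IsDrazinInvertible (z • ContinuousLinearMap.id ℂ X - T)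

theorem apply_mem_range_pow (T : X →L[ℂ] X) (n : ℕ) :
    ∀ x ∈ LinearMap.range ((T ^ n : X →L[ℂ] X) : X →ₗ[ℂ] X),
      T x ∈ LinearMap.range ((T ^ n : X →L[ℂ] X) : X →ₗ[ℂ] X) := by
  rintro _ ⟨y, rfl⟩
  refine ⟨T y, ?_⟩
  have h : T ^ n * T = T * T ^ n := (pow_succ T n).symm.trans (pow_succ' T n)
  exact congrArg (fun A : X →L[ℂ] X => A y) h

/-- The operator `T_[n] : R(T^n) → R(T^n)` induced by `T`. -/
def restrictRangePow (T : X →L[ℂ] X) (n : ℕ) :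
    LinearMap.range ((T ^ n : X →L[ℂ] X) : X →ₗ[ℂ] X) →L[ℂ]
      LinearMap.range ((T ^ n : X →L[ℂ] X) : X →ₗ[ℂ] X) :=
  T.restrict (apply_mem_range_pow T n)

/-- Upper semi B-Fredholm of index `≤ 0`. The index of a semi B-Fredholm operator is the index of
`T_[n]` for any `n` such that `R(T^n)` is closed and `T_[n]` is semi-Fredholm. -/
def IsUpperSemiBWeyl (T : X →L[ℂ] X) : Prop :=
  ∃ n : ℕ, HasClosedRange (T ^ n) ∧ IsUpperSemiFredholm (restrictRangePow T n) ∧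
    index (restrictRangePow T n) ≤ 0

/-- Lower semi B-Fredholm of index `≥ 0`, with the index as in `IsUpperSemiBWeyl`. -/
def IsLowerSemiBWeyl (T : X →L[ℂ] X) : Prop :=
  ∃ n : ℕ, HasClosedRange (T ^ n) ∧ IsLowerSemiFredholm (restrictRangePow T n) ∧
    0 ≤ index (restrictRangePow T n)

/-- `(M, N) ∈ Red(T)`: `M` and `N` are closed `T`-invariant subspaces with `X = M ⊕ N`. -/
structure Reduces (T : X →L[ℂ] X) (M N : Submodule ℂ X) : Prop where
  isClosed_left : IsClosed (M : Set X)
  isClosed_right : IsClosed (N : Set X)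
  invariant_left : ∀ x ∈ M, T x ∈ M
  invariant_right : ∀ x ∈ N, T x ∈ N
  isCompl : IsCompl M N

/-- Generalized Drazin-meromorphic surjective. -/
def IsGDMSurjective (T : X →L[ℂ] X) : Prop :=
  ∃ (M N : Submodule ℂ X) (h : Reduces T M N),
    Function.Surjective (T.restrict h.invariant_left) ∧
      IsMeromorphic (T.restrict h.invariant_right)

/-- Generalized Drazin-meromorphic bounded below. -/
def IsGDMBoundedBelow (T : X →L[ℂ] X) : Prop :=
  ∃ (M N : Submodule ℂ X) (h : Reduces T M N),
    IsBoundedBelow (T.restrict h.invariant_left) ∧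
      IsMeromorphic (T.restrict h.invariant_right)

end BanachOp

end

/-!
The point is to control the summand `N` on which `T` is meromorphic. Every nonzero `z` is isolated
from the rest of the spectrum of a meromorphic operator `B`, so `B - z` is invertible for
arbitrarily small `z` (`IsMeromorphic.isApproxInvertible`), and this passes to the operators
induced on the ranges of powers. For a semi-Fredholm operator `B` with this property, the index
theory needed reduces to elementary perturbation arguments:

* `nullity_le_deficiency`: `α(B) ≤ β(B)`, because kernel vectors of the surjection
  `(x, f) ↦ B x + f`, with `f` in a complement of `R(B)`, perturb to kernel vectors of
  `(x, f) ↦ (B - z) x + f`. In particular a surjective `B` is injective.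
* `IsUpperSemiFredholm.hasFiniteAscentDescent`: `B` has finite ascent and descent. It is onto,
  hence injective, on `⋂ R(B^n)`, which forces `N(B) ∩ R(B^m) = 0` for some `m`; being bounded
  below on `R(B^m)` and a limit of surjective operators there, it is bijective on `R(B^m)`.
* `HasFiniteAscentDescent.deficiency_le_nullity`: consequently `β(B) ≤ α(B)`, a count in the finite
  dimensional space `N(B^m)`.

If `T` is upper semi-Weyl and `T|M` is surjective, then
`α(T) ≤ β(T) ≤ β(T|N) ≤ α(T|N) ≤ α(T)`, all finite, so `N(T) ⊆ N` and `T|M` is bijective. If `T` is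
lower semi-Weyl and `T|M` is injective, then `β(T) ≤ α(T) = α(T|N) ≤ β(T|N) ≤ β(T)`, so `M ⊆ R(T)`
and again `T|M` is bijective. Either way `T` has finite ascent and descent
(`IsUpperSemiWeyl.hasFiniteAscentDescent_of_reduces`,
`IsLowerSemiWeyl.hasFiniteAscentDescent_of_reduces`). For semi B-Weyl operators the same applies to
`T_[n]` on `R(T^n)`, and finite ascent and descent carry over from `T_[n]` to `T`.

Finite ascent and descent are equivalent to Drazin invertibility
(`isDrazinInvertible_iff_hasFiniteAscentDescent`), through the topological decomposition
`X = R(T^m) ⊕ N(T^m)`; that decomposition, on whose summands `T` is bijective and nilpotent, gives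
the converse implications.
-/

noncomputable section

namespace BanachOp

variable {X : Type*} [NormedAddCommGroup X] [NormedSpace ℂ X]

/-! ### Dimension counts -/

theorem nullity_lt_top_iff (T : X →L[ℂ] X) :
    nullity T < ⊤ ↔ FiniteDimensional ℂ (LinearMap.ker (T : X →ₗ[ℂ] X)) := by
  rw [nullity, Cardinal.toENat_lt_top, Module.rank_lt_aleph0_iff]

theorem deficiency_lt_top_iff (T : X →L[ℂ] X) :
    deficiency T < ⊤ ↔ FiniteDimensional ℂ (X ⧸ LinearMap.range (T : X →ₗ[ℂ] X)) := by
  rw [deficiency, Cardinal.toENat_lt_top, Module.rank_lt_aleph0_iff]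

theorem index_le_zero_iff {T : X →L[ℂ] X} :
    index T ≤ 0 ↔ nullity T ≤ deficiency T := by
  rw [index, EReal.sub_nonpos, EReal.coe_ennreal_le_coe_ennreal_iff, ENat.toENNReal_le]

theorem zero_le_index_iff {T : X →L[ℂ] X} (h : deficiency T < ⊤) :
    0 ≤ index T ↔ deficiency T ≤ nullity T := by
  rw [index, EReal.sub_nonneg, EReal.coe_ennreal_le_coe_ennreal_iff, ENat.toENNReal_le]
  · exact Or.inr (by simpa using h.ne)
  · exact Or.inr (by simp)

/-! ### Closed ranges -/

/-- An algebraic complement that is closed forces the range to be closed: `(x, g) ↦ T x + g` is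
a quotient map by the open mapping theorem, and the preimage of `R(T)` is `{g = 0}`. -/
theorem hasClosedRange_of_isCompl [CompleteSpace X] {T : X →L[ℂ] X} {G : Submodule ℂ X}
    (h : IsCompl (LinearMap.range (T : X →ₗ[ℂ] X)) G) (hG : IsClosed (G : Set X)) :
    HasClosedRange T := by
  have := hG.completeSpace_coe
  let S : (X × G) →L[ℂ] X := T.coprod G.subtypeL
  have hS : Function.Surjective S := by
    intro y
    obtain ⟨_, ⟨x, rfl⟩, g, hg, rfl⟩ :=
      Submodule.mem_sup.1 (h.sup_eq_top ▸ Submodule.mem_top : y ∈ _ ⊔ G)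
    exact ⟨(x, ⟨g, hg⟩), by simp [S]⟩
  rw [HasClosedRange, ← (S.isQuotientMap hS).isClosed_preimage]
  convert! isClosed_singleton.preimage (continuous_snd : Continuous (Prod.snd : X × G → G))
    using 1
  swap
  · exact 0
  ext ⟨x, g⟩
  simp only [Set.mem_preimage, SetLike.mem_coe, Set.mem_singleton_iff]
  constructor
  · intro hx
    have hg : (g : X) ∈ LinearMap.range (T : X →ₗ[ℂ] X) := by
      have := Submodule.sub_mem _ hx (LinearMap.mem_range_self (T : X →ₗ[ℂ] X) x)
      simpa [S] using this
    exact Subtype.ext (Submodule.disjoint_def.1 h.disjoint _ hg g.2)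
  · rintro rfl
    exact ⟨x, by simp [S]⟩

theorem IsLowerSemiFredholm.hasClosedRange [CompleteSpace X] {T : X →L[ℂ] X}
    (h : IsLowerSemiFredholm T) : HasClosedRange T := by
  have := (deficiency_lt_top_iff T).1 h
  obtain ⟨G, hG⟩ := (LinearMap.range (T : X →ₗ[ℂ] X)).exists_isCompl
  have : FiniteDimensional ℂ G :=
    LinearEquiv.finiteDimensional (Submodule.quotientEquivOfIsCompl _ G hG)
  exact hasClosedRange_of_isCompl hG G.closed_of_finiteDimensional

/-- The image of `V` is closed because `T` is a quotient map onto its range and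
`T⁻¹(T V) = V + N(T)` is closed. -/
theorem IsUpperSemiFredholm.isClosed_map [CompleteSpace X] {T : X →L[ℂ] X}
    (h : IsUpperSemiFredholm T) {V : Submodule ℂ X} (hV : IsClosed (V : Set X)) :
    IsClosed (V.map (T : X →ₗ[ℂ] X) : Set X) := by
  have := (nullity_lt_top_iff T).1 h.1
  have hcl : IsClosed ((LinearMap.range (T : X →ₗ[ℂ] X)) : Set X) := h.2
  have := hcl.completeSpace_coe
  let S : X →L[ℂ] LinearMap.range (T : X →ₗ[ℂ] X) :=
    T.codRestrict _ (fun x => LinearMap.mem_range_self (T : X →ₗ[ℂ] X) x)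
  have hS : Function.Surjective S := by
    rintro ⟨_, x, rfl⟩
    exact ⟨x, rfl⟩
  have h1 : IsClosed (S '' (V : Set X)) := by
    rw [← (S.isQuotientMap hS).isClosed_preimage]
    convert! V.isClosed_sup_finiteDimensional (LinearMap.ker (T : X →ₗ[ℂ] X)) hV using 1
    ext x
    simp only [Set.mem_preimage, Set.mem_image, SetLike.mem_coe, Submodule.mem_sup]
    constructor
    · rintro ⟨v, hv, hvx⟩
      have hvx' : T v = T x := congrArg Subtype.val hvx
      exact ⟨v, hv, x - v, by simp [hvx'], by simp⟩
    · rintro ⟨v, hv, k, hk, rfl⟩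
      refine ⟨v, hv, Subtype.ext ?_⟩
      have hk' : T k = 0 := hk
      simp [S, hk']
  have h2 := hcl.isClosedEmbedding_subtypeVal.isClosedMap _ h1
  rw [Set.image_image] at h2
  exact h2

theorem map_range_pow (T : X →L[ℂ] X) (n : ℕ) :
    (LinearMap.range ((T ^ n : X →L[ℂ] X) : X →ₗ[ℂ] X)).map (T : X →ₗ[ℂ] X) =
      LinearMap.range ((T ^ (n + 1) : X →L[ℂ] X) : X →ₗ[ℂ] X) := by
  rw [← LinearMap.range_comp, pow_succ']
  rfl

theorem IsUpperSemiFredholm.hasClosedRange_pow [CompleteSpace X] {T : X →L[ℂ] X}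
    (h : IsUpperSemiFredholm T) (n : ℕ) : HasClosedRange (T ^ n) := by
  induction n with
  | zero =>
    have : LinearMap.range ((T ^ 0 : X →L[ℂ] X) : X →ₗ[ℂ] X) = ⊤ := LinearMap.range_id
    simp only [HasClosedRange, this, Submodule.top_coe, isClosed_univ]
  | succ n ih =>
    have := h.isClosed_map ih
    rwa [map_range_pow] at this

/-! ### Operators that are limits of injective or invertible translates -/

/-- If `T - z` is injective for arbitrarily small `z`, then `α(T) ≤ β(T)`. With `F` a complement
of `R(T)`, the map `(x, f) ↦ T x + f` is onto, so vectors of its kernel `N(T) × 0` can be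
perturbed to vectors of the kernel of `(x, f) ↦ (T - z) x + f`, which `(x, f) ↦ f` embeds
in `F`. -/
theorem nullity_le_deficiency [CompleteSpace X] {T : X →L[ℂ] X}
    (hT : ∀ ε > 0, ∃ z : ℂ, ‖z‖ < ε ∧ Function.Injective fun x => T x - z • x) :
    nullity T ≤ deficiency T := by
  by_contra! hlt
  have := (deficiency_lt_top_iff T).1 (lt_of_lt_of_le hlt le_top)
  obtain ⟨F, hF⟩ := (LinearMap.range (T : X →ₗ[ℂ] X)).exists_isCompl
  let e := Submodule.quotientEquivOfIsCompl _ F hF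
  have hFfin : FiniteDimensional ℂ F := LinearEquiv.finiteDimensional e
  have hdef : deficiency T = (Module.finrank ℂ F : ℕ∞) := by
    rw [deficiency, e.rank_eq, ← Module.finrank_eq_rank, Cardinal.toENat_nat]
  have hnull : ((Module.finrank ℂ F + 1 : ℕ) : Cardinal) ≤
      Module.rank ℂ (LinearMap.ker (T : X →ₗ[ℂ] X)) := by
    rw [← Cardinal.natCast_le_toENat]
    rw [hdef] at hlt
    exact_mod_cast Order.add_one_le_of_lt hlt
  obtain ⟨s, hs, hli⟩ := le_rank_iff_exists_linearIndependent_finset.1 hnull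
  let S : (X × F) →L[ℂ] X := T.coprod F.subtypeL
  have hSs : Function.Surjective S := by
    intro y
    obtain ⟨_, ⟨x, rfl⟩, g, hg, rfl⟩ :=
      Submodule.mem_sup.1 (hF.sup_eq_top ▸ Submodule.mem_top : y ∈ _ ⊔ F)
    exact ⟨(x, ⟨g, hg⟩), by simp [S]⟩
  have hSr : S.range = ⊤ := LinearMap.range_eq_top.2 hSs
  let R := S.nonlinearRightInverseOfSurjective hSr
  have hR : 0 < (R.nnnorm : ℝ) := S.nonlinearRightInverseOfSurjective_nnnorm_pos hSr
  let v : s → X × F := fun i => (((i : LinearMap.ker (T : X →ₗ[ℂ] X)) : X), 0)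
  have hv : LinearIndependent ℂ v := by
    have h1 := hli.map' ((LinearMap.inl ℂ X F).comp (Submodule.subtype _))
      (LinearMap.ker_eq_bot.2 (LinearMap.inl_injective.comp Subtype.val_injective))
    exact h1
  have hvz : ∀ i, T (v i).1 = 0 := fun i => (i : LinearMap.ker (T : X →ₗ[ℂ] X)).2
  obtain ⟨δ, hδ, hball⟩ := Metric.isOpen_iff.1
    (isOpen_setOfPred_linearIndependent (𝕜 := ℂ) (E := X × F) (ι := s)) v hv
  -- The bound on `z` keeps `S_z` within `1 / (2 ‖R‖)` of `S` and moves each `v i` by less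
  -- than `δ / 2`.
  let C : ℝ := ∑ i, ‖(v i).1‖
  have hC : ∀ i, ‖(v i).1‖ ≤ C := fun i =>
    Finset.single_le_sum (f := fun i => ‖(v i).1‖) (fun _ _ => norm_nonneg _) (Finset.mem_univ i)
  have hC0 : 0 ≤ C := Finset.sum_nonneg fun _ _ => norm_nonneg _
  let r : ℝ := (R.nnnorm : ℝ)⁻¹
  have hr : 0 < r := inv_pos.2 hR
  obtain ⟨z, hz, hinj⟩ := hT (min (r / 2) (r / 2 * (δ / 2) / (C + 1))) (by positivity)
  have hz1 : ‖z‖ < r / 2 := lt_of_lt_of_le hz (min_le_left _ _)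
  have hz2 : ‖z‖ * (C + 1) < r / 2 * (δ / 2) :=
    (lt_div_iff₀ (by positivity)).1 (lt_of_lt_of_le hz (min_le_right _ _))
  let Sz : X × F → X := fun p => S p - z • p.1
  have happ : ApproximatesLinearOn Sz S Set.univ ‖z‖₊ := by
    intro p _ q _
    have : Sz p - Sz q - S (p - q) = -(z • (p - q).1) := by
      simp only [Sz, map_sub, Prod.fst_sub, smul_sub]; abel
    rw [this, norm_neg, norm_smul]
    exact mul_le_mul_of_nonneg_left (norm_fst_le (p - q)) (norm_nonneg z)
  have hlift : ∀ i, ∃ w : X × F, dist w (v i) ≤ δ / 2 ∧ Sz w = 0 := by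
    intro i
    have hsurj := happ.surjOn_closedBall_of_nonlinearRightInverse R (ε := δ / 2) (b := v i)
      (by positivity) (Set.subset_univ _)
    have h0 : (0 : X) ∈ Metric.closedBall (Sz (v i))
        (((R.nnnorm : ℝ)⁻¹ - (‖z‖₊ : ℝ)) * (δ / 2)) := by
      have hSv : Sz (v i) = -(z • (v i).1) := by
        have : S (v i) = T (v i).1 + ((v i).2 : X) := rfl
        simp only [Sz, this, hvz]
        simp [v]
      rw [Metric.mem_closedBall, dist_zero_left, hSv, norm_neg, norm_smul, coe_nnnorm]
      calc ‖z‖ * ‖(v i).1‖ ≤ ‖z‖ * (C + 1) := by gcongr; linarith [hC i]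
        _ ≤ r / 2 * (δ / 2) := hz2.le
        _ ≤ (r - ‖z‖) * (δ / 2) := by gcongr; linarith
    obtain ⟨w, hw, hw0⟩ := hsurj h0
    exact ⟨w, hw, hw0⟩
  choose w hw hw0 using hlift
  have hwli : LinearIndependent ℂ w := by
    refine hball (Metric.mem_ball.2 (lt_of_le_of_lt ((dist_pi_le_iff (by positivity)).2 hw) ?_))
    linarith
  have hsnd : LinearIndependent ℂ fun i => (w i).2 := by
    rw [Fintype.linearIndependent_iff] at hwli ⊢
    intro g hg
    refine hwli g ?_
    have h2 : (∑ i, g i • w i).2 = 0 := by simpa [Prod.snd_sum] using hg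
    have hlin : Sz (∑ i, g i • w i) = 0 := by
      have : Sz (∑ i, g i • w i) = ∑ i, g i • Sz (w i) := by
        simp only [Sz, map_sum, map_smul, Prod.fst_sum, Prod.smul_fst, smul_sub,
          Finset.sum_sub_distrib, Finset.smul_sum]
        congr 1
        exact Finset.sum_congr rfl fun i _ => smul_comm _ _ _
      rw [this]
      simp [hw0]
    refine Prod.ext (hinj ?_) h2
    have hS2 : S (∑ i, g i • w i) = T (∑ i, g i • w i).1 + ((∑ i, g i • w i).2 : X) := rfl
    have h3 : S (∑ i, g i • w i) - z • (∑ i, g i • w i).1 = 0 := hlin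
    rw [hS2, h2] at h3
    simpa using h3
  have := hsnd.fintype_card_le_finrank
  simp [hs] at this

/-- A limit of surjective translates `T - z` that is bounded below is surjective. -/
theorem surjective_of_isBoundedBelow [CompleteSpace X] {T : X →L[ℂ] X} (hb : IsBoundedBelow T)
    (hT : ∀ ε > 0, ∃ z : ℂ, ‖z‖ < ε ∧ Function.Surjective fun x => T x - z • x) :
    Function.Surjective T := by
  obtain ⟨K, hK0, hK⟩ : ∃ K : ℝ, 0 < K ∧ ∀ x, ‖x‖ ≤ K * ‖T x‖ := by
    obtain ⟨c, hc⟩ := T.antilipschitz_of_injective_of_isClosed_range hb.1 hb.2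
    refine ⟨c + 1, by positivity, fun x => ?_⟩
    have := hc.le_mul_dist x 0
    simp only [dist_zero_right, map_zero] at this
    nlinarith [norm_nonneg (T x)]
  intro y
  suffices hy : y ∈ closure (LinearMap.range (T : X →ₗ[ℂ] X) : Set X) by
    have h2 : IsClosed (LinearMap.range (T : X →ₗ[ℂ] X) : Set X) := hb.2
    rw [h2.closure_eq] at hy
    exact hy
  rw [Metric.mem_closure_iff]
  intro ε hε
  obtain ⟨z, hz, hs⟩ := hT (min (1 / (2 * K)) (ε / (2 * K * (‖y‖ + 1)))) (by positivity)
  obtain ⟨x, hx⟩ := hs y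
  have hz1 : ‖z‖ * (2 * K) < 1 :=
    (lt_div_iff₀ (by positivity)).1 (lt_of_lt_of_le hz (min_le_left _ _))
  have hz2 : ‖z‖ * (2 * K * (‖y‖ + 1)) < ε :=
    (lt_div_iff₀ (by positivity)).1 (lt_of_lt_of_le hz (min_le_right _ _))
  have hTx : T x = y + z • x := by rw [← hx]; simp
  have hxb : ‖x‖ ≤ 2 * K * ‖y‖ := by
    have h1 : ‖x‖ ≤ K * (‖y‖ + ‖z‖ * ‖x‖) := by
      refine (hK x).trans ?_
      rw [hTx, ← norm_smul]
      gcongr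
      exact norm_add_le _ _
    nlinarith [norm_nonneg x]
  refine ⟨T x, ⟨x, rfl⟩, ?_⟩
  rw [hTx, dist_eq_norm, sub_add_cancel_left, norm_neg, norm_smul]
  calc ‖z‖ * ‖x‖ ≤ ‖z‖ * (2 * K * (‖y‖ + 1)) := by
        gcongr
        nlinarith
    _ < ε := hz2

/-! ### Finite ascent and descent -/

theorem pow_succ_apply (T : X →L[ℂ] X) (n : ℕ) (x : X) : (T ^ (n + 1)) x = (T ^ n) (T x) := by
  rw [pow_succ]; rfl

theorem pow_succ_apply' (T : X →L[ℂ] X) (n : ℕ) (x : X) : (T ^ (n + 1)) x = T ((T ^ n) x) := by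
  rw [pow_succ']; rfl

theorem pow_add_apply (T : X →L[ℂ] X) (m n : ℕ) (x : X) :
    (T ^ (m + n)) x = (T ^ m) ((T ^ n) x) := by
  rw [pow_add]; rfl

/-- `N(T^m) = N(T^(m+1))`, elementwise. -/
def KerStableAt (T : X →L[ℂ] X) (m : ℕ) : Prop :=
  ∀ x, (T ^ (m + 1)) x = 0 → (T ^ m) x = 0

/-- `R(T^m) = R(T^(m+1))`, elementwise. -/
def RangeStableAt (T : X →L[ℂ] X) (m : ℕ) : Prop :=
  ∀ x, ∃ y, (T ^ (m + 1)) y = (T ^ m) x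

/-- Ascent and descent are both finite, witnessed by a common bound. -/
def HasFiniteAscentDescent (T : X →L[ℂ] X) : Prop :=
  ∃ m, KerStableAt T m ∧ RangeStableAt T m

theorem KerStableAt.of_pow_add {T : X →L[ℂ] X} {m : ℕ} (h : KerStableAt T m) (k : ℕ) {x : X}
    (hx : (T ^ (m + k)) x = 0) : (T ^ m) x = 0 := by
  induction k generalizing x with
  | zero => exact hx
  | succ k ih =>
    refine h x ?_
    rw [pow_succ_apply]
    exact ih (by rwa [← add_assoc, pow_succ_apply] at hx)

theorem RangeStableAt.exists_pow_add {T : X →L[ℂ] X} {m : ℕ} (h : RangeStableAt T m) (k : ℕ)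
    (x : X) : ∃ y, (T ^ (m + k)) y = (T ^ m) x := by
  induction k with
  | zero => exact ⟨x, rfl⟩
  | succ k ih =>
    obtain ⟨y, hy⟩ := ih
    obtain ⟨w, hw⟩ := h y
    refine ⟨w, ?_⟩
    rw [show m + (k + 1) = k + (m + 1) by ring, pow_add_apply, hw, ← pow_add_apply, add_comm, hy]

theorem KerStableAt.add {T : X →L[ℂ] X} {m : ℕ} (h : KerStableAt T m) (k : ℕ) :
    KerStableAt T (m + k) := by
  intro x hx
  rw [add_comm m k, pow_add_apply, h.of_pow_add (k + 1) hx, map_zero]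

theorem RangeStableAt.add {T : X →L[ℂ] X} {m : ℕ} (h : RangeStableAt T m) (k : ℕ) :
    RangeStableAt T (m + k) := by
  intro x
  obtain ⟨y, hy⟩ := h.exists_pow_add 1 x
  refine ⟨y, ?_⟩
  rw [show m + k + 1 = k + (m + 1) by ring, pow_add_apply, hy, ← pow_add_apply, add_comm]

theorem HasFiniteAscentDescent.of_stableAt {T : X →L[ℂ] X} {p q : ℕ} (hp : KerStableAt T p)
    (hq : RangeStableAt T q) : HasFiniteAscentDescent T :=
  ⟨p + q, hp.add q, add_comm q p ▸ hq.add p⟩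

theorem ascent_lt_top_iff (T : X →L[ℂ] X) : ascent T < ⊤ ↔ ∃ m, KerStableAt T m := by
  simp only [ascent, iInf_lt_iff, exists_prop, ENat.natCast_lt_top, and_true]
  refine exists_congr fun m => ⟨fun h x hx => ?_, fun h => le_antisymm (fun x hx => ?_) (h ·)⟩
  · exact h.ge hx
  · have hx' : (T ^ m) x = 0 := hx
    change (T ^ (m + 1)) x = 0
    rw [pow_succ_apply', hx', map_zero]

theorem descent_lt_top_iff (T : X →L[ℂ] X) : descent T < ⊤ ↔ ∃ m, RangeStableAt T m := by
  simp only [descent, iInf_lt_iff, exists_prop, ENat.natCast_lt_top, and_true]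
  refine exists_congr fun m => ⟨fun h x => ?_, fun h => le_antisymm ?_ ?_⟩
  · exact h.le ⟨x, rfl⟩
  · rintro _ ⟨x, rfl⟩
    exact h x
  · rintro _ ⟨x, rfl⟩
    exact ⟨T x, (pow_succ_apply T m x).symm⟩

theorem isCompl_range_pow_ker_pow {T : X →L[ℂ] X} {m : ℕ} (hk : KerStableAt T m)
    (hr : RangeStableAt T m) :
    IsCompl (LinearMap.range ((T ^ m : X →L[ℂ] X) : X →ₗ[ℂ] X))
      (LinearMap.ker ((T ^ m : X →L[ℂ] X) : X →ₗ[ℂ] X)) := by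
  refine IsCompl.of_eq (Submodule.disjoint_def.1 ?_ |> fun h => (Submodule.eq_bot_iff _).2
    fun x hx => h x hx.1 hx.2) ?_
  · rw [Submodule.disjoint_def]
    rintro _ ⟨y, rfl⟩ hx
    exact hk.of_pow_add m (by rw [pow_add_apply]; exact hx)
  · rw [eq_top_iff]
    rintro x -
    obtain ⟨y, hy⟩ := hr.exists_pow_add m x
    rw [pow_add_apply] at hy
    refine Submodule.mem_sup.2 ⟨(T ^ m) y, ⟨y, rfl⟩, x - (T ^ m) y, ?_, by abel⟩
    change (T ^ m) (x - (T ^ m) y) = 0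
    rw [map_sub, hy, sub_self]

/-! ### Drazin invertibility -/

theorem IsDrazinInvertible.hasFiniteAscentDescent {T : X →L[ℂ] X} (h : IsDrazinInvertible T) :
    HasFiniteAscentDescent T := by
  obtain ⟨n, S, -, hc, -, hn⟩ := h
  have hcn : T ^ (n + 1) * S = S * T ^ (n + 1) :=
    ((show Commute S T from hc).pow_right (n + 1)).eq.symm
  refine ⟨n, fun x hx => ?_, fun x => ⟨S x, ?_⟩⟩
  · rw [← hn, hcn]
    change S ((T ^ (n + 1)) x) = 0
    rw [hx, map_zero]
  · exact congrArg (fun A : X →L[ℂ] X => A x) hn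

/-- If ascent and descent are finite, `X = R(T^m) ⊕ N(T^m)` topologically. With `P` the
projection onto `R(T^m)`, the operator `T P + (1 - P)` is invertible, and its inverse composed
with `P` is the Drazin inverse. -/
theorem HasFiniteAscentDescent.isDrazinInvertible [CompleteSpace X] {T : X →L[ℂ] X}
    (h : HasFiniteAscentDescent T) : IsDrazinInvertible T := by
  obtain ⟨m₀, hk₀, hr₀⟩ := h
  obtain ⟨m, hm, hk, hr⟩ : ∃ m, 0 < m ∧ KerStableAt T m ∧ RangeStableAt T m :=
    ⟨m₀ + 1, Nat.succ_pos _, hk₀.add 1, hr₀.add 1⟩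
  have hcompl := isCompl_range_pow_ker_pow hk hr
  have htop := Submodule.IsCompl.isTopCompl_of_isClosed hcompl
    (hasClosedRange_of_isCompl hcompl (T ^ m).isClosed_ker) (T ^ m).isClosed_ker
  set R := LinearMap.range ((T ^ m : X →L[ℂ] X) : X →ₗ[ℂ] X) with hR
  set K := LinearMap.ker ((T ^ m : X →L[ℂ] X) : X →ₗ[ℂ] X) with hK
  let P : X →L[ℂ] X := Submodule.projectionL R K htop
  have hPR : ∀ x ∈ R, P x = x := fun x hx => Submodule.projectionL_apply_left htop ⟨x, hx⟩
  have hPK : ∀ x ∈ K, P x = 0 := fun x hx => Submodule.projectionL_apply_right htop ⟨x, hx⟩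
  have hPmem : ∀ x, P x ∈ R := fun x => Submodule.projectionL_apply_mem htop x
  have hQmem : ∀ x, x - P x ∈ K := fun x => by
    rw [← Submodule.projectionL_apply_eq_zero_iff htop, map_sub, sub_eq_zero]
    exact (hPR _ (hPmem x)).symm
  have hTR : ∀ x ∈ R, T x ∈ R := apply_mem_range_pow T m
  have hTK : ∀ x ∈ K, T x ∈ K := fun x hx => by
    have hx' : (T ^ m) x = 0 := hx
    change (T ^ m) (T x) = 0
    rw [← pow_succ_apply, pow_succ_apply', hx', map_zero]
  have hTP : T * P = P * T := by
    ext x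
    change T (P x) = P (T x)
    have h1 : P (T x) = P (T (P x)) + P (T (x - P x)) := by
      rw [← map_add, ← map_add, add_sub_cancel]
    rw [h1, hPR _ (hTR _ (hPmem x)), hPK _ (hTK _ (hQmem x)), add_zero]
  have hPP : P * P = P := by
    ext x
    exact hPR _ (hPmem x)
  have hmP : T ^ m * P = T ^ m := by
    ext x
    change (T ^ m) (P x) = (T ^ m) x
    have : (T ^ m) (x - P x) = 0 := hQmem x
    rw [map_sub, sub_eq_zero] at this
    exact this.symm
  let U : X →L[ℂ] X := T * P + (1 - P)
  have hU : ∀ x, U x = T (P x) + (x - P x) := fun x => rfl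
  have hUb : Function.Bijective U := by
    constructor
    · rw [injective_iff_map_eq_zero]
      intro x hx
      rw [hU] at hx
      have h1 : T (P x) = 0 := by
        refine Submodule.disjoint_def.1 hcompl.disjoint _ (hTR _ (hPmem x)) ?_
        rw [eq_neg_of_add_eq_zero_left hx]
        exact K.neg_mem (hQmem x)
      rw [h1, zero_add, sub_eq_zero] at hx
      rw [hx]
      obtain ⟨y, hy⟩ := hPmem x
      have hy' : (T ^ m) y = P x := hy
      rw [← hy', ← pow_succ_apply'] at h1
      rw [← hy', hk y h1]
    · intro y
      obtain ⟨u, hu⟩ := hPmem y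
      obtain ⟨w, hw⟩ := hr u
      refine ⟨(T ^ m) w + (y - P y), ?_⟩
      have hu' : (T ^ m) u = P y := hu
      have h2 : P ((T ^ m) w + (y - P y)) = (T ^ m) w := by
        rw [map_add, hPR ((T ^ m) w) ⟨w, rfl⟩, hPK _ (hQmem y), add_zero]
      rw [hU, h2, ← pow_succ_apply', hw, hu']
      abel
  obtain ⟨V, hV⟩ := ContinuousLinearMap.isUnit_iff_bijective.2 hUb
  have hUP : (V : X →L[ℂ] X) * P = T * P := by
    rw [hV]
    simp only [U, add_mul, sub_mul, mul_assoc, hPP, one_mul, sub_self, add_zero]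
  have hVP : (↑V⁻¹ : X →L[ℂ] X) * (T * P) = P := by rw [← hUP, V.inv_mul_cancel_left]
  have hPT : Commute P T := hTP.symm
  have hcT : Commute (↑V⁻¹ : X →L[ℂ] X) T := by
    refine Commute.units_inv_left ?_
    rw [hV]
    exact ((Commute.refl T).mul_left hPT).add_left ((Commute.one_left T).sub_left hPT)
  refine ⟨m, ↑V⁻¹ * P, hm, (hcT.mul_left hPT).eq, ?_, ?_⟩
  · rw [mul_assoc (↑V⁻¹ : X →L[ℂ] X) P T, ← hTP, hVP, ← mul_assoc]
    have hcP : Commute (↑V⁻¹ : X →L[ℂ] X) P := by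
      refine Commute.units_inv_left ?_
      rw [hV]
      exact (hPT.symm.mul_left (Commute.refl P)).add_left
        ((Commute.one_left P).sub_left (Commute.refl P))
    rw [← hcP.eq, mul_assoc, hPP]
  · rw [pow_succ, mul_assoc, ← mul_assoc T, ← hcT.eq, mul_assoc, hVP, hmP]

theorem isDrazinInvertible_iff_hasFiniteAscentDescent [CompleteSpace X] {T : X →L[ℂ] X} :
    IsDrazinInvertible T ↔ HasFiniteAscentDescent T :=
  ⟨IsDrazinInvertible.hasFiniteAscentDescent, HasFiniteAscentDescent.isDrazinInvertible⟩

/-- Let `S` be the Drazin inverse and `P = T S` the associated idempotent. Then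
`T - w = (T P + (1 - P) - w P) (P - w (1 - P) + T (1 - P))`: the first factor is a small
perturbation of an invertible operator, the second an invertible operator plus a commuting
nilpotent one. -/
theorem IsDrazinInvertible.exists_isUnit_sub [CompleteSpace X] {T : X →L[ℂ] X}
    (h : IsDrazinInvertible T) :
    ∃ δ > 0, ∀ w : ℂ, w ≠ 0 → ‖w‖ < δ → IsUnit (T - w • (1 : X →L[ℂ] X)) := by
  obtain ⟨n, S, hn0, hc, hS, hn⟩ := h
  let P := T * S
  have hPS : P * S = S := by rw [show P = S * T from hc.symm, hS]
  have hPP : P * P = P := by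
    change T * S * P = _
    rw [mul_assoc, show S * P = S by rw [show P = T * S from rfl, ← mul_assoc, hS]]
  have hPT : P * T = T * P := by
    change T * S * T = T * (T * S)
    rw [mul_assoc, hc]
  have hSP : S * P = S := by rw [show P = T * S from rfl, ← mul_assoc, hS]
  have hu : IsUnit (T * P + (1 - P)) := by
    have h1 : (T * P + (1 - P)) * (S + (1 - P)) = 1 := by
      have a1 : T * P * S = P := by rw [mul_assoc, hPS]
      have a2 : T * P * P = T * P := by rw [mul_assoc, hPP]
      simp only [add_mul, mul_add, sub_mul, mul_sub, one_mul, mul_one, a1, a2, hPP, hPS]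
      abel
    have h2 : (S + (1 - P)) * (T * P + (1 - P)) = 1 := by
      have a1 : S * (T * P) = P := by
        rw [← mul_assoc, hc]; exact hPP
      have a2 : P * (T * P) = T * P := by rw [← mul_assoc, hPT, mul_assoc, hPP]
      simp only [add_mul, mul_add, sub_mul, mul_sub, one_mul, mul_one, a1, a2, hPP, hSP]
      abel
    exact ⟨⟨_, _, h1, h2⟩, rfl⟩
  obtain ⟨δ, hδ, hball⟩ := Metric.isOpen_iff.1 Units.isOpen _ hu
  refine ⟨δ / (‖P‖ + 1), by positivity, fun w hw0 hw => ?_⟩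
  have hu1 : IsUnit (T * P + (1 - P) - w • P) := by
    refine hball ?_
    rw [Metric.mem_ball, dist_eq_norm, sub_sub_cancel_left, norm_neg]
    rw [lt_div_iff₀ (by positivity)] at hw
    calc ‖w • P‖ = ‖w‖ * ‖P‖ := norm_smul _ _
      _ ≤ ‖w‖ * (‖P‖ + 1) := by gcongr; linarith
      _ < δ := hw
  have hQ : (1 - P) * (1 - P) = 1 - P := by
    simp only [sub_mul, mul_sub, one_mul, mul_one, hPP]; abel
  have hTQ : Commute T (1 - P) := (Commute.one_right T).sub_right (show Commute T P from hPT.symm)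
  have hnil : IsNilpotent (T * (1 - P)) := by
    refine ⟨n, ?_⟩
    rw [hTQ.mul_pow]
    have hQn : (1 - P) ^ n = 1 - P := (show IsIdempotentElem (1 - P) from hQ).pow_eq hn0.ne'
    rw [hQn, mul_sub, mul_one, ← mul_assoc, ← pow_succ, hn, sub_self]
  have hu2 : IsUnit (P - w • (1 - P) + T * (1 - P)) := by
    refine hnil.isUnit_add_left_of_commute ?_ ?_
    · have hPQ : P * (1 - P) = 0 := by rw [mul_sub, mul_one, hPP, sub_self]
      have hQP : (1 - P) * P = 0 := by rw [sub_mul, one_mul, hPP, sub_self]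
      refine ⟨⟨P - w • (1 - P), P - w⁻¹ • (1 - P), ?_, ?_⟩, rfl⟩
      · rw [sub_mul, mul_sub, mul_sub, smul_mul_assoc, smul_mul_assoc, mul_smul_comm,
          mul_smul_comm, hPP, hQ, hPQ, hQP, smul_smul, mul_inv_cancel₀ hw0, one_smul]
        simp
      · rw [sub_mul, mul_sub, mul_sub, smul_mul_assoc, smul_mul_assoc, mul_smul_comm,
          mul_smul_comm, hPP, hQ, hPQ, hQP, smul_smul, inv_mul_cancel₀ hw0, one_smul]
        simp
    · have hTP : Commute T P := hPT.symm
      have hPQc : Commute (1 - P) P := (Commute.one_left P).sub_left (Commute.refl P)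
      exact (hTP.mul_left hPQc).sub_right ((hTQ.mul_left (Commute.refl _)).smul_right w)
  convert! hu1.mul hu2 using 1
  have a1 : P * (T * P) = T * P := by rw [← mul_assoc, hPT, mul_assoc, hPP]
  simp only [add_mul, mul_add, sub_mul, mul_sub, smul_mul_assoc, mul_smul_comm, one_mul, mul_one,
    mul_assoc, hPP, hPT, a1, smul_add, smul_sub, sub_self, add_zero]
  abel_nf

/-- An operator invertible after arbitrarily small scalar translations, i.e. `0` lies in the
closure of the resolvent set. -/
def IsApproxInvertible (T : X →L[ℂ] X) : Prop :=
  ∀ ε > 0, ∃ z : ℂ, ‖z‖ < ε ∧ Function.Bijective fun x => T x - z • x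

theorem bijective_sub_smul_of_isUnit [CompleteSpace X] {T : X →L[ℂ] X} {z : ℂ}
    (h : IsUnit (T - z • (1 : X →L[ℂ] X))) : Function.Bijective fun x => T x - z • x :=
  ContinuousLinearMap.isUnit_iff_bijective.1 h

theorem IsDrazinInvertible.isApproxInvertible [CompleteSpace X] {T : X →L[ℂ] X}
    (h : IsDrazinInvertible T) : IsApproxInvertible T := by
  obtain ⟨δ, hδ, hu⟩ := h.exists_isUnit_sub
  intro ε hε
  have hpos : 0 < min δ ε / 2 := by positivity
  have hn : ‖((min δ ε / 2 : ℝ) : ℂ)‖ = min δ ε / 2 := by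
    rw [Complex.norm_real, Real.norm_of_nonneg hpos.le]
  have hlt : min δ ε / 2 < min δ ε := half_lt_self (by positivity)
  refine ⟨((min δ ε / 2 : ℝ) : ℂ), ?_, bijective_sub_smul_of_isUnit (hu _ ?_ ?_)⟩
  · rw [hn]; exact hlt.trans_le (min_le_right _ _)
  · exact_mod_cast hpos.ne'
  · rw [hn]; exact hlt.trans_le (min_le_left _ _)

/-- Each nonzero `z` is isolated from the rest of the spectrum, so there are points of the
resolvent set near any small nonzero `z`. -/
theorem IsMeromorphic.isApproxInvertible [CompleteSpace X] {T : X →L[ℂ] X}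
    (h : IsMeromorphic T) : IsApproxInvertible T := by
  intro ε hε
  have hz : ((ε / 2 : ℝ) : ℂ) ≠ 0 := by exact_mod_cast (half_pos hε).ne'
  obtain ⟨w, hw, hb⟩ := (h _ hz).isApproxInvertible (ε / 2) (half_pos hε)
  refine ⟨((ε / 2 : ℝ) : ℂ) - w, ?_, ?_⟩
  · refine (norm_sub_le _ _).trans_lt ?_
    rw [Complex.norm_real, Real.norm_of_nonneg (half_pos hε).le]
    linarith
  · convert! (Equiv.neg X).bijective.comp hb using 1
    ext x
    simp [sub_smul]
    abel

/-! ### Semi-Fredholm operators in the closure of the invertible translates -/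

theorem nullity_eq_zero_iff (T : X →L[ℂ] X) : nullity T = 0 ↔ Function.Injective T := by
  rw [nullity, Cardinal.toENat_eq_zero, rank_zero_iff, Submodule.subsingleton_iff_eq_bot]
  exact LinearMap.ker_eq_bot

theorem deficiency_eq_zero_iff (T : X →L[ℂ] X) : deficiency T = 0 ↔ Function.Surjective T := by
  rw [deficiency, Cardinal.toENat_eq_zero, rank_zero_iff, Submodule.Quotient.subsingleton_iff]
  exact LinearMap.range_eq_top

/-- The decreasing sequence of finite dimensional spaces `N(T) ∩ R(T^n)` is eventually constant. -/
theorem exists_range_pow_stable_on_ker {T : X →L[ℂ] X} (h : nullity T < ⊤) :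
    ∃ m, ∀ n, ∀ x, T x = 0 →
      x ∈ LinearMap.range ((T ^ m : X →L[ℂ] X) : X →ₗ[ℂ] X) →
      x ∈ LinearMap.range ((T ^ n : X →L[ℂ] X) : X →ₗ[ℂ] X) := by
  have := (nullity_lt_top_iff T).1 h
  have hanti : Antitone fun n => LinearMap.range ((T ^ n : X →L[ℂ] X) : X →ₗ[ℂ] X) := by
    refine antitone_nat_of_succ_le fun n => ?_
    rintro _ ⟨x, rfl⟩
    exact ⟨T x, (pow_succ_apply T n x).symm⟩
  let f : ℕ →o (Submodule ℂ (LinearMap.ker (T : X →ₗ[ℂ] X)))ᵒᵈ :=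
    ⟨fun n => OrderDual.toDual ((LinearMap.range ((T ^ n : X →L[ℂ] X) : X →ₗ[ℂ] X)).comap
      (Submodule.subtype _)), fun a b hab => Submodule.comap_mono (hanti hab)⟩
  obtain ⟨m, hm⟩ := IsArtinian.monotone_stabilizes f
  refine ⟨m, fun n x hx hxm => ?_⟩
  rcases le_total m n with hmn | hnm
  · have h1 : (⟨x, hx⟩ : LinearMap.ker (T : X →ₗ[ℂ] X)) ∈ OrderDual.ofDual (f m) := hxm
    rw [hm n hmn] at h1
    exact h1
  · exact hanti hnm hxm

/-- On `⋂ R(T^n)` the operator is surjective, hence injective since its translates are; so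
`N(T) ∩ R(T^m) = 0` for some `m`. Then `T` is bounded below on `R(T^m)`, hence onto. -/
theorem IsUpperSemiFredholm.hasFiniteAscentDescent [CompleteSpace X] {T : X →L[ℂ] X}
    (h : IsUpperSemiFredholm T) (hT : IsApproxInvertible T) : HasFiniteAscentDescent T := by
  obtain ⟨m, hm⟩ := exists_range_pow_stable_on_ker h.1
  let R : ℕ → Submodule ℂ X := fun n => LinearMap.range ((T ^ n : X →L[ℂ] X) : X →ₗ[ℂ] X)
  have hRc : ∀ n, IsClosed (R n : Set X) := h.hasClosedRange_pow
  let Y : Submodule ℂ X := ⨅ n, R n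
  have hYc : IsClosed (Y : Set X) := by
    rw [Submodule.coe_iInf]
    exact isClosed_iInter hRc
  have hmemY : ∀ x, x ∈ Y ↔ ∀ n, x ∈ R n := fun x => Submodule.mem_iInf R
  have hYinv : ∀ x ∈ Y, T x ∈ Y := fun x hx =>
    (hmemY _).2 fun n => apply_mem_range_pow T n x ((hmemY x).1 hx n)
  have := hYc.completeSpace_coe
  have hsurj : Function.Surjective (T.restrict hYinv) := by
    rintro ⟨y, hy⟩
    obtain ⟨x, rfl⟩ := (hmemY y).1 hy (m + 1)
    refine ⟨⟨(T ^ m) x, (hmemY _).2 fun n => ?_⟩, Subtype.ext (pow_succ_apply' T m x).symm⟩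
    obtain ⟨u, hu⟩ := (hmemY _).1 hy (n + m + 1)
    -- Two preimages of the same vector, in `R(T^m)` and in `R(T^(n+m))`, differ by an element of
    -- `N(T) ∩ R(T^m)`, which is contained in `R(T^n)`.
    have hd : (T ^ m) x - (T ^ (n + m)) u ∈ R n := by
      refine hm n _ ?_ ⟨x - (T ^ n) u, ?_⟩
      · have hu' : (T ^ (n + m + 1)) u = (T ^ (m + 1)) x := hu
        rw [map_sub, ← pow_succ_apply', ← pow_succ_apply', hu', sub_self]
      · change (T ^ m) (x - (T ^ n) u) = _
        rw [map_sub, ← pow_add_apply, add_comm n m]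
    have hu2 : (T ^ (n + m)) u ∈ R n := ⟨(T ^ m) u, (pow_add_apply T n m u).symm⟩
    simpa using (R n).add_mem hd hu2
  have hinj : Function.Injective (T.restrict hYinv) := by
    rw [← nullity_eq_zero_iff]
    refine le_antisymm ?_ zero_le
    rw [← (deficiency_eq_zero_iff _).2 hsurj]
    refine nullity_le_deficiency fun ε hε => ?_
    obtain ⟨z, hz, hb⟩ := hT ε hε
    exact ⟨z, hz, fun a b hab => Subtype.ext (hb.1 (congrArg Subtype.val hab))⟩
  have hker : ∀ x, T x = 0 → x ∈ R m → x = 0 := by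
    intro x hx hxm
    have hxY : x ∈ Y := (hmemY x).2 fun n => hm n x hx hxm
    have : T.restrict hYinv ⟨x, hxY⟩ = T.restrict hYinv 0 := Subtype.ext (by simpa using hx)
    exact congrArg Subtype.val (hinj this)
  have hk : KerStableAt T m := fun x hx => hker _ (by rwa [← pow_succ_apply']) ⟨x, rfl⟩
  refine ⟨m, hk, ?_⟩
  have := (hRc m).completeSpace_coe
  have hbb : IsBoundedBelow (T.restrict (apply_mem_range_pow T m)) := by
    constructor
    · rw [injective_iff_map_eq_zero]
      rintro ⟨x, hx⟩ hx0
      exact Subtype.ext (hker x (congrArg Subtype.val hx0) hx)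
    · have hcl : IsClosed ((↑) ⁻¹' (R (m + 1) : Set X) : Set (R m)) :=
        (hRc (m + 1)).preimage continuous_subtype_val
      rw [HasClosedRange]
      convert! hcl using 1
      ext ⟨y, hy⟩
      constructor
      · rintro ⟨⟨_, x, rfl⟩, hx⟩
        exact ⟨x, (pow_succ_apply' T m x).trans (congrArg Subtype.val hx)⟩
      · rintro ⟨x, hx⟩
        exact ⟨⟨(T ^ m) x, x, rfl⟩, Subtype.ext ((pow_succ_apply' T m x).symm.trans hx)⟩
  have hs := surjective_of_isBoundedBelow hbb fun ε hε => by
    obtain ⟨z, hz, hb⟩ := hT ε hε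
    refine ⟨z, hz, ?_⟩
    rintro ⟨_, x, rfl⟩
    obtain ⟨w, rfl⟩ := hb.2 x
    refine ⟨⟨(T ^ m) w, w, rfl⟩, Subtype.ext ?_⟩
    change T ((T ^ m) w) - z • (T ^ m) w = (T ^ m) (T w - z • w)
    rw [map_sub, map_smul, ← pow_succ_apply, ← pow_succ_apply']
  intro x
  obtain ⟨⟨_, w, rfl⟩, hw⟩ := hs ⟨(T ^ m) x, x, rfl⟩
  exact ⟨w, (pow_succ_apply' T m w).trans (congrArg Subtype.val hw)⟩

theorem IsApproxInvertible.nullity_le_deficiency [CompleteSpace X] {T : X →L[ℂ] X}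
    (hT : IsApproxInvertible T) : nullity T ≤ deficiency T :=
  BanachOp.nullity_le_deficiency fun ε hε => (hT ε hε).imp fun _ hz => ⟨hz.1, hz.2.1⟩

theorem IsLowerSemiFredholm.isUpperSemiFredholm [CompleteSpace X] {T : X →L[ℂ] X}
    (h : IsLowerSemiFredholm T) (hT : IsApproxInvertible T) : IsUpperSemiFredholm T :=
  ⟨hT.nullity_le_deficiency.trans_lt h, h.hasClosedRange⟩

theorem finiteDimensional_ker_pow {T : X →L[ℂ] X} (h : nullity T < ⊤) (n : ℕ) :
    FiniteDimensional ℂ (LinearMap.ker ((T ^ n : X →L[ℂ] X) : X →ₗ[ℂ] X)) := by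
  have hT := (nullity_lt_top_iff T).1 h
  induction n with
  | zero =>
    have : LinearMap.ker ((T ^ 0 : X →L[ℂ] X) : X →ₗ[ℂ] X) = ⊥ := LinearMap.ker_id
    rw [this]
    infer_instance
  | succ n ih =>
    rw [← Submodule.fg_iff_finiteDimensional]
    refine Submodule.fg_of_fg_map_of_fg_inf_ker (T : X →ₗ[ℂ] X) ?_ ?_
    · rw [Submodule.fg_iff_finiteDimensional]
      refine Submodule.finiteDimensional_of_le
        (S₂ := LinearMap.ker ((T ^ n : X →L[ℂ] X) : X →ₗ[ℂ] X)) ?_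
      rintro _ ⟨x, hx, rfl⟩
      exact (pow_succ_apply T n x).symm.trans hx
    · rw [Submodule.fg_iff_finiteDimensional]
      exact Submodule.finiteDimensional_of_le inf_le_right


/-- The finite dimensional space `K = N(T^(m+1))` maps onto `X / R(T)`, so `β(T)` is at most
`dim K / T K = dim N(T|K) ≤ α(T)`. -/
theorem HasFiniteAscentDescent.deficiency_le_nullity {T : X →L[ℂ] X}
    (h : HasFiniteAscentDescent T) (hα : nullity T < ⊤) : deficiency T ≤ nullity T := by
  obtain ⟨m, hk, hr⟩ := h
  have hcompl := isCompl_range_pow_ker_pow (hk.add 1) (hr.add 1)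
  have hfin := finiteDimensional_ker_pow hα (m + 1)
  set K := LinearMap.ker ((T ^ (m + 1) : X →L[ℂ] X) : X →ₗ[ℂ] X) with hK
  have hTK : ∀ x ∈ K, (T : X →ₗ[ℂ] X) x ∈ K := fun x hx => by
    have hx' : (T ^ (m + 1)) x = 0 := hx
    change (T ^ (m + 1)) (T x) = 0
    rw [← pow_succ_apply, pow_succ_apply', hx', map_zero]
  let b : K →ₗ[ℂ] K := (T : X →ₗ[ℂ] X).restrict hTK
  let q : (K ⧸ LinearMap.range b) →ₗ[ℂ] (X ⧸ LinearMap.range (T : X →ₗ[ℂ] X)) :=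
    Submodule.mapQ _ _ K.subtype (by rintro _ ⟨x, rfl⟩; exact ⟨x, rfl⟩)
  have hq : Function.Surjective q := by
    intro y
    obtain ⟨x, rfl⟩ := Submodule.mkQ_surjective _ y
    obtain ⟨_, ⟨u, rfl⟩, k, hk', rfl⟩ :=
      Submodule.mem_sup.1 (hcompl.sup_eq_top ▸ Submodule.mem_top : x ∈ _ ⊔ K)
    refine ⟨Submodule.Quotient.mk ⟨k, hk'⟩, ?_⟩
    refine (Submodule.Quotient.eq _).2 ⟨-(T ^ m) u, ?_⟩
    change T (-(T ^ m) u) = k - ((T ^ (m + 1)) u + k)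
    rw [map_neg, ← pow_succ_apply']
    abel
  let i : LinearMap.ker b →ₗ[ℂ] LinearMap.ker (T : X →ₗ[ℂ] X) :=
    (K.subtype.comp (LinearMap.ker b).subtype).codRestrict _
      (fun x => congrArg Subtype.val x.2)
  have hi : Function.Injective i := fun x y hxy => by
    have h0 := congrArg Subtype.val hxy
    exact Subtype.ext (Subtype.ext h0)
  have h1 := LinearMap.rank_le_of_surjective q hq
  have h2 := LinearMap.rank_le_of_injective i hi
  have h3 : Module.rank ℂ (K ⧸ LinearMap.range b) = Module.rank ℂ (LinearMap.ker b) := by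
    rw [← Module.finrank_eq_rank, ← Module.finrank_eq_rank]
    have e1 := b.finrank_range_add_finrank_ker
    have e2 := (LinearMap.range b).finrank_quotient_add_finrank
    congr 1
    omega
  exact OrderHomClass.mono Cardinal.toENat (h1.trans (h3.le.trans h2))

/-! ### Decompositions reducing an operator -/

theorem coe_restrict_pow (T : X →L[ℂ] X) {M : Submodule ℂ X} (h : ∀ x ∈ M, T x ∈ M) (k : ℕ)
    (x : M) : (((T.restrict h) ^ k) x : X) = (T ^ k) x := by
  induction k generalizing x with
  | zero => rfl
  | succ k ih =>
    rw [pow_succ_apply, pow_succ_apply, ih]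
    rfl

theorem Reduces.exists_add {T : X →L[ℂ] X} {M N : Submodule ℂ X} (h : Reduces T M N) (x : X) :
    ∃ a ∈ M, ∃ b ∈ N, a + b = x :=
  Submodule.mem_sup.1 (h.isCompl.sup_eq_top ▸ Submodule.mem_top : x ∈ M ⊔ N)

theorem Reduces.eq_zero_of_add_eq_zero {T : X →L[ℂ] X} {M N : Submodule ℂ X}
    (h : Reduces T M N) {a b : X} (ha : a ∈ M) (hb : b ∈ N) (hab : a + b = 0) :
    a = 0 ∧ b = 0 := by
  have ha0 : a = 0 := by
    refine Submodule.disjoint_def.1 h.isCompl.disjoint a ha ?_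
    rw [eq_neg_of_add_eq_zero_left hab]
    exact N.neg_mem hb
  exact ⟨ha0, by simpa [ha0] using hab⟩

theorem Reduces.eq_of_add_eq {T : X →L[ℂ] X} {M N : Submodule ℂ X}
    (h : Reduces T M N) {a b c d : X} (ha : a ∈ M) (hb : b ∈ N) (hc : c ∈ M) (hd : d ∈ N)
    (hab : a + b = c + d) : a = c ∧ b = d := by
  have := h.eq_zero_of_add_eq_zero (M.sub_mem ha hc) (N.sub_mem hb hd)
    (by rw [sub_add_sub_comm, hab, sub_self])
  exact ⟨sub_eq_zero.1 this.1, sub_eq_zero.1 this.2⟩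

theorem pow_mem_of_invariant {T : X →L[ℂ] X} {M : Submodule ℂ X} (h : ∀ x ∈ M, T x ∈ M)
    (k : ℕ) {x : X} (hx : x ∈ M) : (T ^ k) x ∈ M := by
  rw [← coe_restrict_pow T h k ⟨x, hx⟩]
  exact Subtype.coe_prop _

/-- A summand on which `T` is bijective does not affect finiteness of ascent and descent. -/
theorem Reduces.hasFiniteAscentDescent {T : X →L[ℂ] X} {M N : Submodule ℂ X}
    (h : Reduces T M N) (hM : Function.Bijective (T.restrict h.invariant_left))
    (hN : HasFiniteAscentDescent (T.restrict h.invariant_right)) : HasFiniteAscentDescent T := by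
  obtain ⟨m, hk, hr⟩ := hN
  refine ⟨m, fun x hx => ?_, fun x => ?_⟩
  · obtain ⟨a, ha, b, hb, rfl⟩ := h.exists_add x
    rw [map_add] at hx
    obtain ⟨h1, h2⟩ := h.eq_zero_of_add_eq_zero (pow_mem_of_invariant h.invariant_left _ ha)
      (pow_mem_of_invariant h.invariant_right _ hb) hx
    have ha' : (T ^ m) a = 0 := by
      rw [pow_succ_apply'] at h1
      have ham := pow_mem_of_invariant h.invariant_left m ha
      have : T.restrict h.invariant_left ⟨_, ham⟩ = T.restrict h.invariant_left 0 :=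
        Subtype.ext (by simpa using h1)
      exact congrArg Subtype.val (hM.1 this)
    have hb' : (T ^ m) b = 0 := by
      rw [← coe_restrict_pow T h.invariant_right m ⟨b, hb⟩]
      rw [← coe_restrict_pow T h.invariant_right (m + 1) ⟨b, hb⟩] at h2
      exact congrArg Subtype.val (hk _ (Subtype.ext h2))
    rw [map_add, ha', hb', add_zero]
  · obtain ⟨a, ha, b, hb, rfl⟩ := h.exists_add x
    obtain ⟨a', ha'⟩ := hM.2 ⟨a, ha⟩
    obtain ⟨b', hb'⟩ := hr ⟨b, hb⟩
    have ha2 : T a' = a := congrArg Subtype.val ha'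
    have hb2 := congrArg Subtype.val hb'
    rw [coe_restrict_pow, coe_restrict_pow] at hb2
    exact ⟨a' + b', by rw [map_add, map_add, hb2, pow_succ_apply, ha2]⟩

/-- The inclusion of `N(T|N)` in `N(T)`. -/
def kerRestrictInclusion (T : X →L[ℂ] X) {N : Submodule ℂ X} (h : ∀ x ∈ N, T x ∈ N) :
    LinearMap.ker (T.restrict h : N →ₗ[ℂ] N) →ₗ[ℂ] LinearMap.ker (T : X →ₗ[ℂ] X) :=
  (N.subtype.comp (LinearMap.ker (T.restrict h : N →ₗ[ℂ] N)).subtype).codRestrict _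
    (fun x => congrArg Subtype.val x.2)

theorem kerRestrictInclusion_injective (T : X →L[ℂ] X) {N : Submodule ℂ X}
    (h : ∀ x ∈ N, T x ∈ N) : Function.Injective (kerRestrictInclusion T h) := fun x y hxy => by
  have h0 := congrArg Subtype.val hxy
  exact Subtype.ext (Subtype.ext h0)

theorem nullity_restrict_le (T : X →L[ℂ] X) {N : Submodule ℂ X} (h : ∀ x ∈ N, T x ∈ N) :
    nullity (T.restrict h) ≤ nullity T :=
  OrderHomClass.mono Cardinal.toENat
    (LinearMap.rank_le_of_injective _ (kerRestrictInclusion_injective T h))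

/-- When `N(T|N)` has the finite dimension of `N(T)`, the kernel of `T` lies in `N`. -/
theorem ker_le_of_nullity_le (T : X →L[ℂ] X) {N : Submodule ℂ X} (h : ∀ x ∈ N, T x ∈ N)
    (hT : nullity T < ⊤) (hle : nullity T ≤ nullity (T.restrict h)) {x : X} (hx : T x = 0) :
    x ∈ N := by
  have heq := le_antisymm hle (nullity_restrict_le T h)
  have := (nullity_lt_top_iff T).1 hT
  have := (nullity_lt_top_iff (T.restrict h)).1 (heq ▸ hT)
  have hfr : Module.finrank ℂ (LinearMap.ker (T.restrict h : N →ₗ[ℂ] N)) =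
      Module.finrank ℂ (LinearMap.ker (T : X →ₗ[ℂ] X)) := by
    rw [Module.finrank, Module.finrank, ← Cardinal.toNat_toENat, ← Cardinal.toNat_toENat]
    exact congrArg ENat.toNat heq.symm
  obtain ⟨y, hy⟩ := (LinearMap.injective_iff_surjective_of_finrank_eq_finrank hfr).1
    (kerRestrictInclusion_injective T h) ⟨x, hx⟩
  have hy' : ((y : N) : X) = x := congrArg Subtype.val hy
  rw [← hy']
  exact Subtype.coe_prop _

/-- If `T|M` is onto, `N / R(T|N)` maps onto `X / R(T)`. -/
theorem Reduces.deficiency_le_of_surjective {T : X →L[ℂ] X} {M N : Submodule ℂ X}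
    (h : Reduces T M N) (hM : Function.Surjective (T.restrict h.invariant_left)) :
    deficiency T ≤ deficiency (T.restrict h.invariant_right) := by
  let q : (N ⧸ LinearMap.range (T.restrict h.invariant_right : N →ₗ[ℂ] N)) →ₗ[ℂ]
      (X ⧸ LinearMap.range (T : X →ₗ[ℂ] X)) :=
    Submodule.mapQ _ _ N.subtype (by rintro _ ⟨x, rfl⟩; exact ⟨x, rfl⟩)
  refine OrderHomClass.mono Cardinal.toENat (LinearMap.rank_le_of_surjective q fun y => ?_)
  obtain ⟨x, rfl⟩ := Submodule.mkQ_surjective _ y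
  obtain ⟨a, ha, b, hb, rfl⟩ := h.exists_add x
  obtain ⟨a', ha'⟩ := hM ⟨a, ha⟩
  have ha2 : T a' = a := congrArg Subtype.val ha'
  refine ⟨Submodule.Quotient.mk ⟨b, hb⟩, (Submodule.Quotient.eq _).2 ⟨-(a' : X), ?_⟩⟩
  change T (-(a' : X)) = b - (a + b)
  rw [map_neg, ha2]
  abel

/-- The map `X / R(T) → N / R(T|N)` induced by the projection onto `N` along `M`. -/
def Reduces.quotientMap {T : X →L[ℂ] X} {M N : Submodule ℂ X} (h : Reduces T M N) :
    (X ⧸ LinearMap.range (T : X →ₗ[ℂ] X)) →ₗ[ℂ]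
      (N ⧸ LinearMap.range (T.restrict h.invariant_right : N →ₗ[ℂ] N)) :=
  Submodule.mapQ _ _ (Submodule.projectionOnto N M h.isCompl.symm) (by
    rintro _ ⟨x, rfl⟩
    obtain ⟨a, ha, b, hb, rfl⟩ := h.exists_add x
    refine ⟨⟨b, hb⟩, ?_⟩
    have h1 := Submodule.projectionOnto_apply_right h.isCompl.symm ⟨T a, h.invariant_left a ha⟩
    have h2 := Submodule.projectionOnto_apply_left h.isCompl.symm ⟨T b, h.invariant_right b hb⟩
    simp only [ContinuousLinearMap.coe_coe, map_add] at h1 h2 ⊢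
    rw [h1, h2, zero_add]
    rfl)

theorem Reduces.quotientMap_surjective {T : X →L[ℂ] X} {M N : Submodule ℂ X}
    (h : Reduces T M N) : Function.Surjective h.quotientMap := by
  intro y
  obtain ⟨b, rfl⟩ := Submodule.mkQ_surjective _ y
  refine ⟨Submodule.Quotient.mk (b : X), ?_⟩
  exact congrArg (Submodule.mkQ _) (Submodule.projectionOnto_apply_left h.isCompl.symm b)

theorem Reduces.quotientMap_mk_of_mem {T : X →L[ℂ] X} {M N : Submodule ℂ X}
    (h : Reduces T M N) {a : X} (ha : a ∈ M) : h.quotientMap (Submodule.Quotient.mk a) = 0 :=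
  (congrArg (Submodule.mkQ _)
    (Submodule.projectionOnto_apply_right h.isCompl.symm ⟨a, ha⟩)).trans (map_zero _)

theorem Reduces.deficiency_right_le {T : X →L[ℂ] X} {M N : Submodule ℂ X} (h : Reduces T M N) :
    deficiency (T.restrict h.invariant_right) ≤ deficiency T :=
  OrderHomClass.mono Cardinal.toENat
    (LinearMap.rank_le_of_surjective h.quotientMap h.quotientMap_surjective)

theorem Reduces.hasClosedRange_right {T : X →L[ℂ] X} {M N : Submodule ℂ X}
    (h : Reduces T M N) (hT : HasClosedRange T) :
    HasClosedRange (T.restrict h.invariant_right) := by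
  have hcl : IsClosed ((↑) ⁻¹' (LinearMap.range (T : X →ₗ[ℂ] X) : Set X) : Set N) :=
    IsClosed.preimage continuous_subtype_val hT
  rw [HasClosedRange]
  convert! hcl using 1
  ext ⟨y, hy⟩
  constructor
  · rintro ⟨x, hx⟩
    exact ⟨x, congrArg Subtype.val hx⟩
  · rintro ⟨x, hx⟩
    obtain ⟨a, ha, b, hb, rfl⟩ := h.exists_add x
    have hx' : T a + T b = 0 + y := by rw [← map_add, zero_add]; exact hx
    have := h.eq_of_add_eq (h.invariant_left a ha) (h.invariant_right b hb) M.zero_mem hy hx'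
    exact ⟨⟨b, hb⟩, Subtype.ext this.2⟩

/-- `α(T) ≤ β(T) ≤ β(T|N) ≤ α(T|N) ≤ α(T) < ∞` gives `N(T) ⊆ N`, so `T|M` is also injective. -/
theorem IsUpperSemiWeyl.hasFiniteAscentDescent_of_reduces [CompleteSpace X] {T : X →L[ℂ] X}
    {M N : Submodule ℂ X} (hT : IsUpperSemiWeyl T) (h : Reduces T M N)
    (hM : Function.Surjective (T.restrict h.invariant_left))
    (hN : IsApproxInvertible (T.restrict h.invariant_right)) : HasFiniteAscentDescent T := by
  have := h.isClosed_right.completeSpace_coe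
  obtain ⟨⟨hα, hcl⟩, hind⟩ := hT
  rw [index_le_zero_iff] at hind
  have hαN := (nullity_restrict_le T h.invariant_right).trans_lt hα
  have hB : IsUpperSemiFredholm (T.restrict h.invariant_right) :=
    ⟨hαN, h.hasClosedRange_right hcl⟩
  have hfin := hB.hasFiniteAscentDescent hN
  have hle := hind.trans ((h.deficiency_le_of_surjective hM).trans
    (hfin.deficiency_le_nullity hαN))
  refine h.hasFiniteAscentDescent ⟨?_, hM⟩ hfin
  rw [injective_iff_map_eq_zero]
  rintro ⟨a, ha⟩ ha0
  have hTa : T a = 0 := congrArg Subtype.val ha0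
  exact Subtype.ext (Submodule.disjoint_def.1 h.isCompl.disjoint a ha
    (ker_le_of_nullity_le T h.invariant_right hα hle hTa))

/-- `β(T) ≤ α(T) = α(T|N) ≤ β(T|N) ≤ β(T) < ∞` makes the surjection `X / R(T) → N / R(T|N)`
injective, so that `M ⊆ R(T)` and `T|M` is also surjective. -/
theorem IsLowerSemiWeyl.hasFiniteAscentDescent_of_reduces [CompleteSpace X] {T : X →L[ℂ] X}
    {M N : Submodule ℂ X} (hT : IsLowerSemiWeyl T) (h : Reduces T M N)
    (hM : Function.Injective (T.restrict h.invariant_left))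
    (hN : IsApproxInvertible (T.restrict h.invariant_right)) : HasFiniteAscentDescent T := by
  have := h.isClosed_right.completeSpace_coe
  obtain ⟨hβ, hind⟩ := hT
  rw [zero_le_index_iff hβ] at hind
  have hβN : IsLowerSemiFredholm (T.restrict h.invariant_right) :=
    h.deficiency_right_le.trans_lt hβ
  have hfin := (hβN.isUpperSemiFredholm hN).hasFiniteAscentDescent hN
  have hker : nullity T ≤ nullity (T.restrict h.invariant_right) := by
    have hmem : ∀ x : LinearMap.ker (T : X →ₗ[ℂ] X), (x : X) ∈ N := by
      rintro ⟨x, hx⟩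
      obtain ⟨a, ha, b, hb, rfl⟩ := h.exists_add x
      have hx' : T a + T b = 0 := by rw [← map_add]; exact hx
      have h0 := (h.eq_zero_of_add_eq_zero (h.invariant_left a ha) (h.invariant_right b hb) hx').1
      have : T.restrict h.invariant_left ⟨a, ha⟩ = T.restrict h.invariant_left 0 :=
        Subtype.ext (by simpa using h0)
      have ha0 : a = 0 := congrArg Subtype.val (hM this)
      simpa [ha0] using hb
    let j : LinearMap.ker (T : X →ₗ[ℂ] X) →ₗ[ℂ]
        LinearMap.ker (T.restrict h.invariant_right : N →ₗ[ℂ] N) :=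
      ((LinearMap.ker (T : X →ₗ[ℂ] X)).subtype.codRestrict N hmem).codRestrict _
        (fun x => Subtype.ext x.2)
    refine OrderHomClass.mono Cardinal.toENat (LinearMap.rank_le_of_injective j fun x y hxy => ?_)
    have h0 := congrArg Subtype.val (congrArg Subtype.val hxy)
    exact Subtype.ext h0
  have heq : deficiency T = deficiency (T.restrict h.invariant_right) :=
    le_antisymm (hind.trans (hker.trans hN.nullity_le_deficiency)) h.deficiency_right_le
  have := (deficiency_lt_top_iff T).1 hβ
  have := (deficiency_lt_top_iff _).1 hβN
  have hfr : Module.finrank ℂ (X ⧸ LinearMap.range (T : X →ₗ[ℂ] X)) = Module.finrank ℂ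
      (N ⧸ LinearMap.range (T.restrict h.invariant_right : N →ₗ[ℂ] N)) := by
    rw [Module.finrank, Module.finrank, ← Cardinal.toNat_toENat, ← Cardinal.toNat_toENat]
    exact congrArg ENat.toNat heq
  have hqi := (LinearMap.injective_iff_surjective_of_finrank_eq_finrank hfr).2
    h.quotientMap_surjective
  refine h.hasFiniteAscentDescent ⟨hM, ?_⟩ hfin
  rintro ⟨a, ha⟩
  have h0 : (Submodule.Quotient.mk a : X ⧸ LinearMap.range (T : X →ₗ[ℂ] X)) = 0 :=
    hqi ((h.quotientMap_mk_of_mem ha).trans (map_zero _).symm)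
  obtain ⟨x, hx⟩ := (Submodule.Quotient.mk_eq_zero _).1 h0
  obtain ⟨c, hc, d, hd, rfl⟩ := h.exists_add x
  have hx' : T c + T d = a + 0 := by rw [← map_add, add_zero]; exact hx
  have := h.eq_of_add_eq (h.invariant_left c hc) (h.invariant_right d hd) ha N.zero_mem hx'
  exact ⟨⟨c, hc⟩, Subtype.ext this.1⟩

/-! ### The operators induced on the ranges of powers -/

theorem hasFiniteAscentDescent_of_restrictRangePow {T : X →L[ℂ] X} {n : ℕ}
    (h : HasFiniteAscentDescent (restrictRangePow T n)) : HasFiniteAscentDescent T := by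
  obtain ⟨m, hk, hr⟩ := h
  have hcoe : ∀ k x, ((restrictRangePow T n ^ k) ⟨(T ^ n) x, x, rfl⟩ : X) = (T ^ (k + n)) x :=
    fun k x => (coe_restrict_pow T _ k _).trans (pow_add_apply T k n x).symm
  refine ⟨m + n, fun x hx => ?_, fun x => ?_⟩
  · rw [← hcoe]
    refine congrArg Subtype.val (hk _ (Subtype.ext ?_))
    rw [hcoe, add_right_comm]
    exact hx
  · obtain ⟨⟨_, y, rfl⟩, hy⟩ := hr ⟨(T ^ n) x, x, rfl⟩
    refine ⟨y, ?_⟩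
    have := congrArg Subtype.val hy
    rw [hcoe] at this
    rw [← this, add_right_comm]
    exact (hcoe (m + 1) y).symm

theorem Reduces.restrictRangePow {T : X →L[ℂ] X} {M N : Submodule ℂ X} (h : Reduces T M N)
    (n : ℕ) :
    Reduces (restrictRangePow T n)
      (M.comap (LinearMap.range ((T ^ n : X →L[ℂ] X) : X →ₗ[ℂ] X)).subtype)
      (N.comap (LinearMap.range ((T ^ n : X →L[ℂ] X) : X →ₗ[ℂ] X)).subtype) where
  isClosed_left := h.isClosed_left.preimage continuous_subtype_val
  isClosed_right := h.isClosed_right.preimage continuous_subtype_val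
  invariant_left x hx := h.invariant_left x hx
  invariant_right x hx := h.invariant_right x hx
  isCompl := by
    refine IsCompl.of_eq ((Submodule.eq_bot_iff _).2 ?_) (eq_top_iff.2 ?_)
    · rintro x ⟨hx1, hx2⟩
      exact Subtype.ext (Submodule.disjoint_def.1 h.isCompl.disjoint _ hx1 hx2)
    · rintro ⟨_, x, rfl⟩ -
      obtain ⟨a, ha, b, hb, rfl⟩ := h.exists_add x
      exact Submodule.mem_sup.2 ⟨⟨(T ^ n) a, a, rfl⟩, pow_mem_of_invariant h.invariant_left n ha,
        ⟨(T ^ n) b, b, rfl⟩, pow_mem_of_invariant h.invariant_right n hb,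
        Subtype.ext (map_add (T ^ n) a b).symm⟩

theorem Reduces.exists_mem_left_pow_eq {T : X →L[ℂ] X} {M N : Submodule ℂ X} (h : Reduces T M N)
    {n : ℕ} {x : X} (hx : (T ^ n) x ∈ M) : ∃ a ∈ M, (T ^ n) a = (T ^ n) x := by
  obtain ⟨a, ha, b, hb, rfl⟩ := h.exists_add x
  refine ⟨a, ha, (h.eq_of_add_eq (pow_mem_of_invariant h.invariant_left n ha)
    (pow_mem_of_invariant h.invariant_right n hb) hx N.zero_mem ?_).1⟩
  rw [← map_add, add_zero]

theorem Reduces.symm {T : X →L[ℂ] X} {M N : Submodule ℂ X} (h : Reduces T M N) :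
    Reduces T N M :=
  ⟨h.isClosed_right, h.isClosed_left, h.invariant_right, h.invariant_left, h.isCompl.symm⟩

theorem Reduces.restrictRangePow_surjective {T : X →L[ℂ] X} {M N : Submodule ℂ X}
    (h : Reduces T M N) (n : ℕ) (hM : Function.Surjective (T.restrict h.invariant_left)) :
    Function.Surjective
      ((BanachOp.restrictRangePow T n).restrict (h.restrictRangePow n).invariant_left) := by
  rintro ⟨⟨_, x, rfl⟩, hx⟩
  obtain ⟨a, ha, hax⟩ := h.exists_mem_left_pow_eq hx
  obtain ⟨⟨c, hc⟩, hc'⟩ := hM ⟨a, ha⟩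
  have hc2 : T c = a := congrArg Subtype.val hc'
  refine ⟨⟨⟨(T ^ n) c, c, rfl⟩, pow_mem_of_invariant h.invariant_left n hc⟩,
    Subtype.ext (Subtype.ext ?_)⟩
  change T ((T ^ n) c) = (T ^ n) x
  rw [← pow_succ_apply', pow_succ_apply, hc2, hax]

theorem Reduces.restrictRangePow_injective {T : X →L[ℂ] X} {M N : Submodule ℂ X}
    (h : Reduces T M N) (n : ℕ) (hM : Function.Injective (T.restrict h.invariant_left)) :
    Function.Injective
      ((BanachOp.restrictRangePow T n).restrict (h.restrictRangePow n).invariant_left) := by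
  intro x y hxy
  have h0 := congrArg Subtype.val (congrArg Subtype.val hxy)
  have h1 := @hM ⟨x.1.1, x.2⟩ ⟨y.1.1, y.2⟩ (Subtype.ext h0)
  have h2 := congrArg Subtype.val h1
  exact Subtype.ext (Subtype.ext h2)

theorem Reduces.restrictRangePow_isApproxInvertible {T : X →L[ℂ] X} {M N : Submodule ℂ X}
    (h : Reduces T M N) (n : ℕ) (hN : IsApproxInvertible (T.restrict h.invariant_right)) :
    IsApproxInvertible
      ((BanachOp.restrictRangePow T n).restrict (h.restrictRangePow n).invariant_right) := by
  intro ε hε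
  obtain ⟨z, hz, hb⟩ := hN ε hε
  refine ⟨z, hz, fun x y hxy => ?_, ?_⟩
  · have h0 := congrArg Subtype.val (congrArg Subtype.val hxy)
    have h1 := @hb.1 ⟨x.1.1, x.2⟩ ⟨y.1.1, y.2⟩ (Subtype.ext h0)
    have h2 := congrArg Subtype.val h1
    exact Subtype.ext (Subtype.ext h2)
  · rintro ⟨⟨_, x, rfl⟩, hx⟩
    obtain ⟨b, hb', hbx⟩ := h.symm.exists_mem_left_pow_eq hx
    obtain ⟨⟨c, hc⟩, hc'⟩ := hb.2 ⟨b, hb'⟩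
    have hc2 : T c - z • c = b := congrArg Subtype.val hc'
    refine ⟨⟨⟨(T ^ n) c, c, rfl⟩, pow_mem_of_invariant h.invariant_right n hc⟩,
      Subtype.ext (Subtype.ext ?_)⟩
    change T ((T ^ n) c) - z • (T ^ n) c = (T ^ n) x
    rw [← hbx, ← hc2, map_sub, map_smul, ← pow_succ_apply, ← pow_succ_apply']

/-! ### The decomposition of a Drazin invertible operator -/

theorem bijective_restrictRangePow {T : X →L[ℂ] X} {m : ℕ} (hk : KerStableAt T m)
    (hr : RangeStableAt T m) : Function.Bijective (restrictRangePow T m) := by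
  constructor
  · rw [injective_iff_map_eq_zero]
    rintro ⟨_, x, rfl⟩ hx
    have hx' : T ((T ^ m) x) = 0 := congrArg Subtype.val hx
    rw [← pow_succ_apply'] at hx'
    exact Subtype.ext (hk x hx')
  · rintro ⟨_, x, rfl⟩
    obtain ⟨y, hy⟩ := hr x
    exact ⟨⟨(T ^ m) y, y, rfl⟩, Subtype.ext ((pow_succ_apply' T m y).symm.trans hy)⟩

theorem hasClosedRange_of_surjective {T : X →L[ℂ] X} (h : Function.Surjective T) :
    HasClosedRange T := by
  rw [HasClosedRange, LinearMap.range_eq_top.2 h]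
  exact isClosed_univ

theorem isDrazinInvertible_of_isUnit {T : X →L[ℂ] X} (h : IsUnit T) : IsDrazinInvertible T := by
  obtain ⟨u, rfl⟩ := h
  exact ⟨1, ↑u⁻¹, one_pos, by simp, by simp, by simp [pow_succ]⟩

theorem isMeromorphic_of_isNilpotent {T : X →L[ℂ] X} (h : IsNilpotent T) : IsMeromorphic T := by
  intro z hz
  refine isDrazinInvertible_of_isUnit ?_
  rw [sub_eq_add_neg]
  have hu : IsUnit (z • ContinuousLinearMap.id ℂ X) :=
    (isUnit_one (M := X →L[ℂ] X)).smul (Units.mk0 z hz)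
  exact h.neg.isUnit_add_left_of_commute hu ((Commute.one_right (-T)).smul_right z)

theorem HasFiniteAscentDescent.exists_reduces [CompleteSpace X] {T : X →L[ℂ] X}
    (h : HasFiniteAscentDescent T) :
    ∃ (M N : Submodule ℂ X) (h : Reduces T M N),
      Function.Bijective (T.restrict h.invariant_left) ∧
        IsMeromorphic (T.restrict h.invariant_right) := by
  obtain ⟨m, hk, hr⟩ := h
  have hc := isCompl_range_pow_ker_pow hk hr
  have hinv : ∀ x ∈ LinearMap.ker ((T ^ m : X →L[ℂ] X) : X →ₗ[ℂ] X),
      T x ∈ LinearMap.ker ((T ^ m : X →L[ℂ] X) : X →ₗ[ℂ] X) := fun x hx => by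
    have hx' : (T ^ m) x = 0 := hx
    change (T ^ m) (T x) = 0
    rw [← pow_succ_apply, pow_succ_apply', hx', map_zero]
  refine ⟨_, _, ⟨hasClosedRange_of_isCompl hc (T ^ m).isClosed_ker, (T ^ m).isClosed_ker,
    apply_mem_range_pow T m, hinv, hc⟩, bijective_restrictRangePow hk hr,
    isMeromorphic_of_isNilpotent ⟨m, ?_⟩⟩
  ext x
  rw [coe_restrict_pow]
  exact x.2

theorem HasFiniteAscentDescent.isGDMSurjective [CompleteSpace X] {T : X →L[ℂ] X}
    (h : HasFiniteAscentDescent T) : IsGDMSurjective T := by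
  obtain ⟨M, N, hr, hM, hN⟩ := h.exists_reduces
  exact ⟨M, N, hr, hM.2, hN⟩

theorem HasFiniteAscentDescent.isGDMBoundedBelow [CompleteSpace X] {T : X →L[ℂ] X}
    (h : HasFiniteAscentDescent T) : IsGDMBoundedBelow T := by
  obtain ⟨M, N, hr, hM, hN⟩ := h.exists_reduces
  exact ⟨M, N, hr, ⟨hM.1, hasClosedRange_of_surjective hM.2⟩, hN⟩

theorem HasFiniteAscentDescent.isUpperSemiBWeyl_and_isLowerSemiBWeyl [CompleteSpace X]
    {T : X →L[ℂ] X} (h : HasFiniteAscentDescent T) :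
    IsUpperSemiBWeyl T ∧ IsLowerSemiBWeyl T := by
  obtain ⟨m, hk, hr⟩ := h
  have hcl := hasClosedRange_of_isCompl (isCompl_range_pow_ker_pow hk hr) (T ^ m).isClosed_ker
  have hb := bijective_restrictRangePow hk hr
  have hα := (nullity_eq_zero_iff _).2 hb.1
  have hβ := (deficiency_eq_zero_iff _).2 hb.2
  have hβt : deficiency (restrictRangePow T m) < ⊤ := by simp [hβ]
  refine ⟨⟨m, hcl, ⟨by simp [hα], hasClosedRange_of_surjective hb.2⟩, ?_⟩, ⟨m, hcl, hβt, ?_⟩⟩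
  · rw [index_le_zero_iff, hα, hβ]
  · rw [zero_le_index_iff hβt, hα, hβ]

theorem IsUpperSemiBWeyl.hasFiniteAscentDescent [CompleteSpace X] {T : X →L[ℂ] X}
    (h : IsUpperSemiBWeyl T) (hT : IsGDMSurjective T) : HasFiniteAscentDescent T := by
  obtain ⟨n, hcl, hn⟩ := h
  obtain ⟨M, N, hr, hM, hN⟩ := hT
  have := IsClosed.completeSpace_coe (hs := hcl)
  have := hr.isClosed_right.completeSpace_coe
  exact hasFiniteAscentDescent_of_restrictRangePow <|
    IsUpperSemiWeyl.hasFiniteAscentDescent_of_reduces hn (hr.restrictRangePow n)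
      (hr.restrictRangePow_surjective n hM)
      (hr.restrictRangePow_isApproxInvertible n hN.isApproxInvertible)

theorem IsLowerSemiBWeyl.hasFiniteAscentDescent [CompleteSpace X] {T : X →L[ℂ] X}
    (h : IsLowerSemiBWeyl T) (hT : IsGDMBoundedBelow T) : HasFiniteAscentDescent T := by
  obtain ⟨n, hcl, hn⟩ := h
  obtain ⟨M, N, hr, hM, hN⟩ := hT
  have := IsClosed.completeSpace_coe (hs := hcl)
  have := hr.isClosed_right.completeSpace_coe
  exact hasFiniteAscentDescent_of_restrictRangePow <|
    IsLowerSemiWeyl.hasFiniteAscentDescent_of_reduces hn (hr.restrictRangePow n)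
      (hr.restrictRangePow_injective n hM.1)
      (hr.restrictRangePow_isApproxInvertible n hN.isApproxInvertible)

/-! ### Browder operators -/

theorem isBrowder_iff (T : X →L[ℂ] X) :
    IsBrowder T ↔ IsUpperSemiFredholm T ∧ IsLowerSemiFredholm T ∧ HasFiniteAscentDescent T := by
  rw [IsBrowder, IsUpperSemiBrowder, IsLowerSemiBrowder, ascent_lt_top_iff, descent_lt_top_iff]
  constructor
  · rintro ⟨⟨hu, p, hp⟩, hl, q, hq⟩
    exact ⟨hu, hl, .of_stableAt hp hq⟩
  · rintro ⟨hu, hl, m, hk, hr⟩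
    exact ⟨⟨hu, m, hk⟩, hl, m, hr⟩

theorem HasFiniteAscentDescent.isApproxInvertible [CompleteSpace X] {T : X →L[ℂ] X}
    (h : HasFiniteAscentDescent T) : IsApproxInvertible T :=
  h.isDrazinInvertible.isApproxInvertible

theorem HasFiniteAscentDescent.isBrowder_of_upper [CompleteSpace X] {T : X →L[ℂ] X}
    (h : HasFiniteAscentDescent T) (hT : IsUpperSemiFredholm T) : IsBrowder T :=
  (isBrowder_iff T).2 ⟨hT, (h.deficiency_le_nullity hT.1).trans_lt hT.1, h⟩

/-- `T` lies in the closure of its invertible translates, so `β(T) < ∞` bounds `α(T)`. -/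
theorem HasFiniteAscentDescent.isBrowder_of_lower [CompleteSpace X] {T : X →L[ℂ] X}
    (h : HasFiniteAscentDescent T) (hT : IsLowerSemiFredholm T) : IsBrowder T :=
  (isBrowder_iff T).2 ⟨hT.isUpperSemiFredholm h.isApproxInvertible, hT, h⟩

theorem IsBrowder.isUpperSemiWeyl [CompleteSpace X] {T : X →L[ℂ] X} (h : IsBrowder T) :
    IsUpperSemiWeyl T := by
  obtain ⟨hu, -, hf⟩ := (isBrowder_iff T).1 h
  exact ⟨hu, index_le_zero_iff.2 hf.isApproxInvertible.nullity_le_deficiency⟩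

theorem IsBrowder.isLowerSemiWeyl {T : X →L[ℂ] X} (h : IsBrowder T) :
    IsLowerSemiWeyl T := by
  obtain ⟨hu, hl, hf⟩ := (isBrowder_iff T).1 h
  exact ⟨hl, (zero_le_index_iff hl).2 (hf.deficiency_le_nullity hu.1)⟩

theorem IsUpperSemiWeyl.isBrowder [CompleteSpace X] {T : X →L[ℂ] X} (h : IsUpperSemiWeyl T)
    (hT : IsGDMSurjective T) : IsBrowder T := by
  obtain ⟨M, N, hr, hM, hN⟩ := hT
  have := hr.isClosed_right.completeSpace_coe
  exact (h.hasFiniteAscentDescent_of_reduces hr hM hN.isApproxInvertible).isBrowder_of_upper h.1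

theorem IsLowerSemiWeyl.isBrowder [CompleteSpace X] {T : X →L[ℂ] X} (h : IsLowerSemiWeyl T)
    (hT : IsGDMBoundedBelow T) : IsBrowder T := by
  obtain ⟨M, N, hr, hM, hN⟩ := hT
  have := hr.isClosed_right.completeSpace_coe
  exact (h.hasFiniteAscentDescent_of_reduces hr hM.1 hN.isApproxInvertible).isBrowder_of_lower h.1

end BanachOp

end

theorem mainTheorem3 {X : Type*} [NormedAddCommGroup X] [NormedSpace ℂ X] [CompleteSpace X]
    (T : X →L[ℂ] X) :
    (BanachOp.IsDrazinInvertible T ↔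
      BanachOp.IsUpperSemiBWeyl T ∧ BanachOp.IsGDMSurjective T) ∧
    (BanachOp.IsDrazinInvertible T ↔
      BanachOp.IsLowerSemiBWeyl T ∧ BanachOp.IsGDMBoundedBelow T) ∧
    (BanachOp.IsBrowder T ↔
      BanachOp.IsUpperSemiWeyl T ∧ BanachOp.IsGDMSurjective T) ∧
    (BanachOp.IsBrowder T ↔
      BanachOp.IsLowerSemiWeyl T ∧ BanachOp.IsGDMBoundedBelow T) := by
  simp only [BanachOp.isDrazinInvertible_iff_hasFiniteAscentDescent]
  refine ⟨⟨fun h => ⟨h.isUpperSemiBWeyl_and_isLowerSemiBWeyl.1, h.isGDMSurjective⟩,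
      fun h => h.1.hasFiniteAscentDescent h.2⟩,
    ⟨fun h => ⟨h.isUpperSemiBWeyl_and_isLowerSemiBWeyl.2, h.isGDMBoundedBelow⟩,
      fun h => h.1.hasFiniteAscentDescent h.2⟩,
    ⟨fun h => ⟨h.isUpperSemiWeyl, ?_⟩, fun h => h.1.isBrowder h.2⟩,
    ⟨fun h => ⟨h.isLowerSemiWeyl, ?_⟩, fun h => h.1.isBrowder h.2⟩⟩
  · exact ((BanachOp.isBrowder_iff T).1 h).2.2.isGDMSurjective
  · exact ((BanachOp.isBrowder_iff T).1 h).2.2.isGDMBoundedBelow
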